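/- Let $l^1$ and $l^\infty$ be the complex sequence spaces with their usual norms, let $L(l^1)$ be the Banach space of bounded linear operators on $l^1$ with the operator norm, and for $S\in L(l^1)$ let $S^*\colon l^\infty\to l^\infty$ be the Banach space adjoint of $S$ (identifying $(l^1)^*$ with $l^\infty$ through $\langle y,x\rangle=\sum_n y_nx_n$) and $S^{**}\colon (l^\infty)^*\to (l^\infty)^*$ the adjoint of $S^*$. For a bounded linear operator $T$ on a complex Banach space $X$ and $x\in X$ let $J_T(x)$ be the set of all $y\in X$ for which there are a strictly increasing sequence of natural numbers $(k_n)$ and a sequence $(x_n)$ in $X$ with $x_n\to x$ and $T^{k_n}x_n\to y$. The operator $T$ is called $J$-class if $J_T(x)=X$ for some $x\in X\setminus\{0\}$. Write $\sigma(T)$ for the spectrum of $T$, $\sigma_p(T)$ for its set of eigenvalues, and $\mathbb D$ for the open unit disc in $\mathbb C$. Then the set $$JA(l^1):=\{S\in L(l^1): S^*\text{ is }J\text{-class}\}$$ satisfies $$JA(l^1)=\{S\in L(l^1): \sigma(S)\cap\partial\mathbb D\neq\emptyset,\ \overline{\mathbb D}\cap\sigma_p(S^{**})=\emptyset\},$$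 and it is open in $L(l^1)$ with respect to the norm topology. -/

import Mathlib

open Filter Topology
open scoped ENNReal

noncomputable section

namespace JClass

/-- The complex sequence space `l^1`. -/
abbrev LOne : Type := lp (fun _ : ℕ => ℂ) 1

/-- The complex sequence space `l^∞`, with the sup norm. -/
abbrev LInf : Type := lp (fun _ : ℕ => ℂ) ∞

section General

variable {X : Type*} [NormedAddCommGroup X] [NormedSpace ℂ X]

/-- The Banach space adjoint `f ↦ f ∘ T` of `T`, acting on the norm dual of `X`. -/
def dualMap (T : X →L[ℂ] X) : StrongDual ℂ X →L[ℂ] StrongDual ℂ X :=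
  ContinuousLinearMap.precomp ℂ T

/-- The `J`-set of `x` under `T`. -/
def JSet (T : X →L[ℂ] X) (x : X) : Set X :=
  {y | ∃ (k : ℕ → ℕ) (u : ℕ → X), StrictMono k ∧
    Tendsto u atTop (𝓝 x) ∧ Tendsto (fun n => (T ^ k n) (u n)) atTop (𝓝 y)}

/-- `T` is a `J`-class operator: the `J`-set of some nonzero vector is the whole space. -/
def IsJClass (T : X →L[ℂ] X) : Prop :=
  ∃ x : X, x ≠ 0 ∧ JSet T x = Set.univ

/-- The point spectrum (set of eigenvalues) of `T`. -/
def pointSpectrum (T : X →L[ℂ] X) : Set ℂ :=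
  {μ | Module.End.HasEigenvalue (T : X →ₗ[ℂ] X) μ}

end General

/-- The canonical pairing `y ↦ (x ↦ ∑ n, y n * x n)` of `l^∞` with `l^1`. -/
def pairing : LInf →L[ℂ] StrongDual ℂ LOne :=
  lp.dualPairing ∞ 1 (fun _ : ℕ => ContinuousLinearMap.mul ℂ ℂ) (K := 1)
    (fun _ => by simp)

theorem pairing_apply (y : LInf) (x : LOne) : pairing y x = ∑' n, y n * x n := rfl

theorem pairing_single (y : LInf) (n : ℕ) : pairing y (lp.single 1 n 1) = y n := by
  rw [pairing_apply, tsum_eq_single n]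
  · simp
  · intro m hm
    have h : (lp.single 1 n 1 : LOne) m = 0 :=
      lp.single_apply_ne (E := fun _ : ℕ => ℂ) 1 n (1 : ℂ) hm
    exact mul_eq_zero_of_right _ h

theorem norm_apply_single_le (f : StrongDual ℂ LOne) (n : ℕ) :
    ‖f (lp.single 1 n 1)‖ ≤ ‖f‖ := by
  have h := f.le_opNorm (lp.single 1 n 1)
  rwa [lp.norm_single (by norm_num), norm_one, mul_one] at h

/-- The sequence of values of a functional on `l^1` at the unit vectors. -/
def coeffs (f : StrongDual ℂ LOne) : LInf :=
  ⟨fun n => f (lp.single 1 n 1),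
    memℓp_infty ⟨‖f‖, by rintro _ ⟨n, rfl⟩; exact norm_apply_single_le f n⟩⟩

theorem pairing_coeffs (f : StrongDual ℂ LOne) : pairing (coeffs f) = f := by
  refine lp.ext_continuousLinearMap (by norm_num) fun n => ?_
  ext
  exact pairing_single _ n

theorem norm_pairing (y : LInf) : ‖pairing y‖ = ‖y‖ := by
  apply le_antisymm
  · have h := pairing.le_of_opNorm_le
      (lp.norm_dualPairing (p := ∞) (q := 1) (fun _ : ℕ => ContinuousLinearMap.mul ℂ ℂ) (K := 1)
        (fun _ => by simp)) y
    simpa using h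
  · refine lp.norm_le_of_forall_le (norm_nonneg _) fun n => ?_
    rw [← pairing_single y n]
    exact norm_apply_single_le _ n

/-- The canonical isometric isomorphism of `l^∞` with the norm dual of `l^1`. -/
def lInfEquivDual : LInf ≃ₗᵢ[ℂ] StrongDual ℂ LOne :=
  LinearIsometryEquiv.ofSurjective
    { toLinearMap := (pairing : LInf →ₗ[ℂ] StrongDual ℂ LOne), norm_map' := norm_pairing }
    (fun f => ⟨coeffs f, pairing_coeffs f⟩)

/-- The adjoint `S* : l^∞ → l^∞` of `S : l^1 → l^1`, under the canonical identification of
`(l^1)*` with `l^∞`. -/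
def adjointLInf (S : LOne →L[ℂ] LOne) : LInf →L[ℂ] LInf :=
  (lInfEquivDual.symm.toContinuousLinearEquiv : StrongDual ℂ LOne →L[ℂ] LInf) ∘L dualMap S ∘L
    (lInfEquivDual.toContinuousLinearEquiv : LInf →L[ℂ] StrongDual ℂ LOne)

/-- The defining duality relation `⟨S* y, x⟩ = ⟨y, S x⟩`. -/
theorem tsum_adjointLInf (S : LOne →L[ℂ] LOne) (y : LInf) (x : LOne) :
    ∑' n, adjointLInf S y n * x n = ∑' n, y n * S x n := by
  have h : lInfEquivDual (adjointLInf S y) = dualMap S (lInfEquivDual y) :=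
    lInfEquivDual.apply_symm_apply _
  exact DFunLike.congr_fun h x

/-- The set `JA(l^1)` of operators on `l^1` whose adjoint on `l^∞` is `J`-class. -/
def JA : Set (LOne →L[ℂ] LOne) :=
  {S | IsJClass (adjointLInf S)}

end JClass

end

/-! Both claims follow from one description (`JA_eq_discExpanding`): `S*` is `J`-class iff `S - μ`
is bounded below and not invertible for every `|μ| ≤ 1`. For one `μ` this is an open condition on `S
- μ`, and compactness of the disc makes it open in `S`. Non-invertibility at a single point of the
disc spreads to all of it, since frontier points of the spectrum are approximate eigenvalues.

The Schur property of `l^1` links this to `S**`: unit vectors that are almost killed by `S - μ` have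
a nonzero weak* cluster point in the bidual, an eigenvector of `S**`. The same device applied to
long orbit segments that stay bounded would give a nonzero bounded orbit of `S**`;
`eq_zero_of_bounded_orbit` forbids it, so the powers of `S` expand uniformly.

Expansion lets one solve `S*^k g = y` with `g` small, and adding a nonzero `f ∈ ker S*` gives `y ∈
J(f)`. Conversely, an eigenfunctional of `S**` with `|μ| ≤ 1` would be bounded on every `J`-set, and
if `S` were invertible the powers of `S*` would expand, keeping `0` out of `J(x)` for `x ≠ 0`. -/

noncomputable section

namespace JClass

/-! ### Operators bounded below, invertibility and the spectrum -/

section BoundedBelow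

variable {E : Type*} [NormedAddCommGroup E] [NormedSpace ℂ E]

/-- An operator is bounded below if `c * ‖x‖ ≤ ‖A x‖` for some `c > 0`. -/
def BoundedBelow (A : E →L[ℂ] E) : Prop :=
  ∃ c > 0, ∀ x, c * ‖x‖ ≤ ‖A x‖

theorem BoundedBelow.injective {A : E →L[ℂ] E} (hA : BoundedBelow A) : Function.Injective A := by
  obtain ⟨c, hc, h⟩ := hA
  refine (injective_iff_map_eq_zero A).2 fun x hx => ?_
  have := h x
  rw [hx, norm_zero] at this
  exact norm_eq_zero.1 (le_antisymm (nonpos_of_mul_nonpos_right this hc) (norm_nonneg x))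

/-- A perturbation of size `r` lowers the lower bound by at most `r`. -/
theorem lowerBound_perturb {A B : E →L[ℂ] E} {c r : ℝ} (h : ∀ x, c * ‖x‖ ≤ ‖A x‖)
    (hr : ‖A - B‖ ≤ r) (x : E) : (c - r) * ‖x‖ ≤ ‖B x‖ := by
  have h1 := (A - B).le_of_opNorm_le hr x
  rw [sub_apply] at h1
  have h2 := norm_sub_norm_le (A x) (B x)
  linarith [h x]

theorem isOpen_boundedBelow : IsOpen {A : E →L[ℂ] E | BoundedBelow A} := by
  refine Metric.isOpen_iff.2 ?_
  rintro A ⟨c, hc, h⟩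
  refine ⟨c / 2, by positivity, fun B hB => ⟨c / 2, by positivity, fun x => ?_⟩⟩
  rw [Metric.mem_ball, dist_comm, dist_eq_norm] at hB
  have := lowerBound_perturb h hB.le x
  linarith

/-- A nearby unit `u` inherits a lower bound from `A`, which controls `u⁻¹`; then `A = (1 - (u -
A)u⁻¹)u` is invertible by the Neumann series. -/
theorem BoundedBelow.isUnit_of_mem_closure [CompleteSpace E] {A : E →L[ℂ] E}
    (hA : BoundedBelow A) (hcl : A ∈ closure {B : E →L[ℂ] E | IsUnit B}) : IsUnit A := by
  obtain ⟨c, hc, h⟩ := hA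
  -- With distance `c/3`, `u` keeps the lower bound `2c/3`, so `‖(u - A)u⁻¹‖ ≤ 1/2`.
  obtain ⟨_, ⟨u, rfl⟩, hu⟩ := Metric.mem_closure_iff.1 hcl (c / 3) (by positivity)
  rw [dist_eq_norm] at hu
  have hinv : ‖(↑u⁻¹ : E →L[ℂ] E)‖ ≤ (2 * c / 3)⁻¹ := by
    refine ContinuousLinearMap.opNorm_le_bound _ (by positivity) fun x => ?_
    have h1 := lowerBound_perturb h hu.le ((↑u⁻¹ : E →L[ℂ] E) x)
    rw [← mul_apply_eq_comp, Units.mul_inv, one_apply_eq_self] at h1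
    rw [inv_mul_eq_div, le_div_iff₀ (by positivity)]
    linarith
  have h1 : ‖((u : E →L[ℂ] E) - A) * (↑u⁻¹ : E →L[ℂ] E)‖ < 1 := by
    calc _ ≤ ‖(u : E →L[ℂ] E) - A‖ * ‖(↑u⁻¹ : E →L[ℂ] E)‖ := norm_mul_le _ _
      _ ≤ c / 3 * (2 * c / 3)⁻¹ := by
        rw [norm_sub_rev]; gcongr
      _ < 1 := by field_simp; norm_num
  have h2 := isUnit_one_sub_of_norm_lt_one h1
  have h3 : A = (1 - ((u : E →L[ℂ] E) - A) * (↑u⁻¹ : E →L[ℂ] E)) * u := by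
    rw [sub_mul, mul_assoc, Units.inv_mul]; simp
  rw [h3]
  exact h2.mul u.isUnit

theorem isOpen_boundedBelow_not_isUnit [CompleteSpace E] :
    IsOpen {A : E →L[ℂ] E | BoundedBelow A ∧ ¬ IsUnit A} := by
  have : {A : E →L[ℂ] E | BoundedBelow A ∧ ¬ IsUnit A} =
      {A | BoundedBelow A} ∩ (closure {A | IsUnit A})ᶜ := by
    ext A
    exact ⟨fun h => ⟨h.1, fun hc => h.2 (h.1.isUnit_of_mem_closure hc)⟩,
      fun h => ⟨h.1, fun hu => h.2 (subset_closure hu)⟩⟩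
  rw [this]
  exact isOpen_boundedBelow.inter isClosed_closure.isOpen_compl

theorem mem_spectrum_iff (A : E →L[ℂ] E) (μ : ℂ) :
    μ ∈ spectrum ℂ A ↔ ¬ IsUnit (A - algebraMap ℂ (E →L[ℂ] E) μ) := by
  rw [spectrum.mem_iff, ← IsUnit.neg_iff, neg_sub]

/-- Frontier points of the spectrum belong to the approximate point spectrum. -/
theorem not_boundedBelow_of_mem_frontier [CompleteSpace E] {A : E →L[ℂ] E} {μ : ℂ}
    (hμ : μ ∈ frontier (spectrum ℂ A)) : ¬ BoundedBelow (A - algebraMap ℂ (E →L[ℂ] E) μ) := by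
  intro hbb
  rw [(spectrum.isClosed A).frontier_eq, Set.mem_sdiff, ← Set.mem_compl_iff,
    ← closure_compl] at hμ
  refine (mem_spectrum_iff A μ).1 hμ.1 (hbb.isUnit_of_mem_closure ?_)
  have hcont : Continuous fun z : ℂ => A - algebraMap ℂ (E →L[ℂ] E) z :=
    continuous_const.sub (algebraMapCLM ℂ (E →L[ℂ] E)).continuous
  refine map_mem_closure (f := fun z : ℂ => A - algebraMap ℂ (E →L[ℂ] E) z) hcont hμ.2 fun z hz => ?_
  by_contra h
  exact hz ((mem_spectrum_iff A z).2 h)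

/-- No frontier point of the spectrum lies in `K`, so the spectrum is relatively clopen in `K`. -/
theorem subset_spectrum_of_boundedBelow [CompleteSpace E] {A : E →L[ℂ] E} {K : Set ℂ}
    (hK : IsPreconnected K) (hbb : ∀ μ ∈ K, BoundedBelow (A - algebraMap ℂ (E →L[ℂ] E) μ))
    (hne : (spectrum ℂ A ∩ K).Nonempty) : K ⊆ spectrum ℂ A := by
  have hfr : ∀ μ ∈ K, μ ∉ frontier (spectrum ℂ A) := fun μ hμ hf =>
    not_boundedBelow_of_mem_frontier hf (hbb μ hμ)
  have hint : ∀ μ ∈ K, μ ∈ spectrum ℂ A → μ ∈ interior (spectrum ℂ A) := fun μ hμ hs => by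
    by_contra h
    exact hfr μ hμ ⟨subset_closure hs, h⟩
  intro μ hμ
  by_contra hμs
  obtain ⟨ν, hν, hνK⟩ := hne
  obtain ⟨z, -, hz1, hz2⟩ := hK (interior (spectrum ℂ A)) (spectrum ℂ A)ᶜ isOpen_interior
    (spectrum.isClosed A).isOpen_compl
    (fun z hz => (em (z ∈ spectrum ℂ A)).imp (hint z hz) id) ⟨ν, hνK, hint ν hνK hν⟩
    ⟨μ, hμ, hμs⟩
  exact hz2 (interior_subset hz1)

end BoundedBelow

/-! ### Adjoints of operators bounded below -/

section Dual

variable {E : Type*} [NormedAddCommGroup E] [NormedSpace ℂ E]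

theorem dualMap_apply (A : E →L[ℂ] E) (f : StrongDual ℂ E) (x : E) : dualMap A f x = f (A x) := rfl

theorem dualMap_sub_algebraMap_apply (A : E →L[ℂ] E) (μ : ℂ) (f : StrongDual ℂ E) :
    dualMap (A - algebraMap ℂ (E →L[ℂ] E) μ) f = dualMap A f - μ • f := by
  ext x
  simp [dualMap_apply, Algebra.algebraMap_eq_smul_one]

theorem dualMap_dualMap_sub_algebraMap_apply (A : E →L[ℂ] E) (μ : ℂ)
    (φ : StrongDual ℂ (StrongDual ℂ E)) :
    dualMap (dualMap (A - algebraMap ℂ (E →L[ℂ] E) μ)) φ = dualMap (dualMap A) φ - μ • φ := by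
  ext f
  change φ (dualMap (A - algebraMap ℂ (E →L[ℂ] E) μ) f) = φ (dualMap A f) - μ • φ f
  rw [dualMap_sub_algebraMap_apply, map_sub, map_smul]

/-- Solving `A* g = f` with a norm bound, when `A` is bounded below. -/
theorem exists_dualMap_eq {A : E →L[ℂ] E} {c : ℝ} (hc : 0 < c) (h : ∀ x, c * ‖x‖ ≤ ‖A x‖)
    (f : StrongDual ℂ E) : ∃ g : StrongDual ℂ E, dualMap A g = f ∧ c * ‖g‖ ≤ ‖f‖ := by
  have hinj : Function.Injective (A : E →ₗ[ℂ] E) := BoundedBelow.injective ⟨c, hc, h⟩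
  let e := LinearEquiv.ofInjective (A : E →ₗ[ℂ] E) hinj
  have hbound : ∀ y, ‖((f : E →ₗ[ℂ] ℂ) ∘ₗ e.symm.toLinearMap) y‖ ≤ ‖f‖ / c * ‖y‖ := by
    intro y
    obtain ⟨x, rfl⟩ := e.surjective y
    have h1 : ‖e x‖ = ‖A x‖ := rfl
    simp only [LinearMap.comp_apply, LinearEquiv.coe_coe, LinearEquiv.symm_apply_apply,
      ContinuousLinearMap.coe_coe, h1]
    calc ‖f x‖ ≤ ‖f‖ * ‖x‖ := f.le_opNorm x
      _ = ‖f‖ / c * (c * ‖x‖) := by field_simp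
      _ ≤ _ := by gcongr; exact h x
  let g₀ := LinearMap.mkContinuous ((f : E →ₗ[ℂ] ℂ) ∘ₗ e.symm.toLinearMap) (‖f‖ / c) hbound
  obtain ⟨g, hg, hgn⟩ := exists_extension_norm_eq _ g₀
  refine ⟨g, ?_, ?_⟩
  · ext x
    have h1 : g (A x) = g₀ (e x) := hg (e x)
    have h2 : g₀ (e x) = f (e.symm (e x)) := rfl
    rw [dualMap_apply, h1, h2, e.symm_apply_apply]
  · have : ‖g₀‖ ≤ ‖f‖ / c := LinearMap.mkContinuous_norm_le _ (by positivity) _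
    rw [hgn, ← le_div_iff₀' hc]
    exact this

/-- `A*` is onto with norm control, so `φ` is determined quantitatively by its values on the
functionals `A* g`. -/
theorem BoundedBelow.dualMap_dualMap {A : E →L[ℂ] E} (hA : BoundedBelow A) :
    BoundedBelow (dualMap (dualMap A)) := by
  obtain ⟨c, hc, h⟩ := hA
  refine ⟨c, hc, fun φ => ?_⟩
  rw [← le_div_iff₀' hc]
  refine φ.opNorm_le_bound (by positivity) fun f => ?_
  obtain ⟨g, rfl, hg⟩ := exists_dualMap_eq hc h f
  calc ‖φ (dualMap A g)‖ = ‖dualMap (dualMap A) φ g‖ := rfl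
    _ ≤ ‖dualMap (dualMap A) φ‖ * ‖g‖ := ContinuousLinearMap.le_opNorm _ _
    _ = ‖dualMap (dualMap A) φ‖ / c * (c * ‖g‖) := by field_simp
    _ ≤ _ := by gcongr

/-- The range is closed and proper, so Hahn–Banach on the quotient gives a nonzero functional
vanishing on it. -/
theorem BoundedBelow.exists_dualMap_eq_zero [CompleteSpace E] {A : E →L[ℂ] E}
    (hA : BoundedBelow A) (hu : ¬ IsUnit A) : ∃ f : StrongDual ℂ E, f ≠ 0 ∧ dualMap A f = 0 := by
  have hinj := hA.injective
  obtain ⟨c, hc, h⟩ := hA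
  have hcl : IsClosed (Set.range A) := by
    refine (AntilipschitzWith.of_le_mul_dist (K := Real.toNNReal c⁻¹) fun x y => ?_).isClosed_range
      A.uniformContinuous
    rw [dist_eq_norm, dist_eq_norm, ← map_sub, Real.coe_toNNReal _ (inv_pos.2 hc).le, ← div_eq_inv_mul, le_div_iff₀' hc]
    exact h _
  have hns : ¬ Function.Surjective A := fun hs => hu <| by
    let e := ContinuousLinearEquiv.ofBijective A (LinearMap.ker_eq_bot.2 hinj)
      (LinearMap.range_eq_top.2 hs)
    exact ⟨ContinuousLinearEquiv.toUnit e, by ext x; rfl⟩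
  simp only [Function.Surjective, not_forall] at hns
  obtain ⟨y, hy⟩ := hns
  let p : Submodule ℂ E := (A : E →ₗ[ℂ] E).range
  have hp : IsClosed (p : Set E) := hcl
  have := hp
  have hy0 : (p.mkQ y : E ⧸ p) ≠ 0 := by
    rw [Submodule.mkQ_apply, Ne, Submodule.Quotient.mk_eq_zero]
    rintro ⟨x, hx⟩
    exact hy ⟨x, hx⟩
  obtain ⟨f, hf⟩ := SeparatingDual.exists_ne_zero (R := ℂ) hy0
  refine ⟨f ∘L p.mkQL, fun h0 => hf ?_, ?_⟩
  · exact DFunLike.congr_fun h0 y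
  · ext x
    have : p.mkQ (A x) = 0 := by
      rw [Submodule.mkQ_apply, Submodule.Quotient.mk_eq_zero]
      exact ⟨x, rfl⟩
    change f (p.mkQ (A x)) = 0
    rw [this, map_zero]

end Dual

/-! ### Bounded orbits and approximate eigenvalues -/

section PowerBounded

variable {E : Type*} [NormedAddCommGroup E] [NormedSpace ℂ E]

theorem exists_not_boundedBelow [CompleteSpace E] [Nontrivial E] (A : E →L[ℂ] E) :
    ∃ μ : ℂ, ‖μ‖ ≤ ‖A‖ ∧ ¬ BoundedBelow (A - algebraMap ℂ (E →L[ℂ] E) μ) := by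
  obtain ⟨μ, hμ⟩ : (frontier (spectrum ℂ A)).Nonempty :=
    nonempty_frontier_iff.2 ⟨spectrum.nonempty A,
      (spectrum.isCompact (𝕜 := ℂ) A).ne_univ⟩
  exact ⟨μ, spectrum.norm_le_norm_of_mem ((spectrum.isClosed A).frontier_subset hμ),
    not_boundedBelow_of_mem_frontier hμ⟩

/-- The bounded forward orbits of `A`, as a subspace of `l^∞(E)`. -/
def boundedOrbits (A : E →L[ℂ] E) : Submodule ℂ (lp (fun _ : ℕ => E) ∞) where
  carrier := {a | ∀ k, a (k + 1) = A (a k)}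
  zero_mem' k := by simp
  add_mem' ha hb k := by simp [ha k, hb k]
  smul_mem' c a ha k := by simp [ha k]

theorem isClosed_boundedOrbits (A : E →L[ℂ] E) :
    IsClosed (boundedOrbits A : Set (lp (fun _ : ℕ => E) ∞)) := by
  have h : (boundedOrbits A : Set (lp (fun _ : ℕ => E) ∞)) =
      ⋂ k, {a | a (k + 1) = A (a k)} := by
    ext a; simp only [Set.mem_iInter, Set.mem_ofPred_eq]; rfl
  rw [h]
  have hev : ∀ k, Continuous fun a : lp (fun _ : ℕ => E) ∞ => a k := fun k =>
    (lp.evalCLM ℂ (fun _ : ℕ => E) ∞ k).continuous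
  exact isClosed_iInter fun k => isClosed_eq (hev _) (A.continuous.comp (hev k))

theorem norm_boundedOrbits_apply_le {A : E →L[ℂ] E} (a : boundedOrbits A) (k : ℕ) :
    ‖(a : lp (fun _ : ℕ => E) ∞) k‖ ≤ ‖a‖ :=
  lp.norm_apply_le_norm (by simp) (a : lp (fun _ : ℕ => E) ∞) k

/-- The left shift on bounded orbits, which acts as `A` on each entry. -/
def orbitShift (A : E →L[ℂ] E) : boundedOrbits A →L[ℂ] boundedOrbits A :=
  LinearMap.mkContinuous
    { toFun := fun a => ⟨⟨fun k => (a : lp (fun _ : ℕ => E) ∞) (k + 1),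
        memℓp_infty ⟨‖a‖, by rintro _ ⟨k, rfl⟩; exact norm_boundedOrbits_apply_le a _⟩⟩,
        fun k => a.2 (k + 1)⟩
      map_add' := fun _ _ => rfl
      map_smul' := fun _ _ => rfl } 1 fun a => by
    rw [one_mul]
    exact lp.norm_le_of_forall_le (norm_nonneg _) fun k => norm_boundedOrbits_apply_le a _

theorem orbitShift_apply (A : E →L[ℂ] E) (a : boundedOrbits A) (k : ℕ) :
    (orbitShift A a : lp (fun _ : ℕ => E) ∞) k = A ((a : lp (fun _ : ℕ => E) ∞) k) :=
  a.2 k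

theorem norm_orbitShift_le (A : E →L[ℂ] E) : ‖orbitShift A‖ ≤ 1 :=
  LinearMap.mkContinuous_norm_le _ zero_le_one _

/-- An operator without approximate eigenvalues in the closed unit disc has no nonzero bounded
orbit. -/
theorem eq_zero_of_bounded_orbit [CompleteSpace E] {A : E →L[ℂ] E}
    (hA : ∀ μ : ℂ, ‖μ‖ ≤ 1 → ∃ c > 0, ∀ x, c * ‖x‖ ≤ ‖A x - μ • x‖) {x : E} {C : ℝ}
    (hx : ∀ k, ‖A^[k] x‖ ≤ C) : x = 0 := by
  by_contra hx0
  let a : boundedOrbits A := ⟨⟨fun k => A^[k] x, memℓp_infty ⟨C, by rintro _ ⟨k, rfl⟩; exact hx k⟩⟩,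
    fun k => Function.iterate_succ_apply' A k x⟩
  have ha : a ≠ 0 := fun h => hx0 (congrFun (congrArg (fun b : boundedOrbits A =>
    ((b : lp (fun _ : ℕ => E) ∞) : ℕ → E)) h) 0)
  have : Nontrivial (boundedOrbits A) := ⟨⟨a, 0, ha⟩⟩
  have : CompleteSpace (boundedOrbits A) := (isClosed_boundedOrbits A).completeSpace_coe
  -- The shift is a contraction, so it has an approximate eigenvalue in the closed disc; but it acts
  -- as `A` on each entry and so inherits the lower bound of `A - μ`.
  obtain ⟨μ, hμ, hμbb⟩ := exists_not_boundedBelow (orbitShift A)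
  refine hμbb ?_
  obtain ⟨c, hc, h⟩ := hA μ (hμ.trans (norm_orbitShift_le A))
  refine ⟨c, hc, fun b => ?_⟩
  rw [← le_div_iff₀' hc]
  refine lp.norm_le_of_forall_le (by positivity) fun k => ?_
  rw [le_div_iff₀' hc]
  refine (h _).trans ?_
  refine le_trans (le_of_eq (congrArg norm ?_)) (norm_boundedOrbits_apply_le _ k)
  rw [Algebra.algebraMap_eq_smul_one]
  exact congrArg (· - μ • (b : lp (fun _ : ℕ => E) ∞) k) (orbitShift_apply A b k).symm

end PowerBounded

/-! ### Consequences of the Schur property -/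

section Schur

variable {E : Type*} [NormedAddCommGroup E] [NormedSpace ℂ E]

/-- In a space with the Schur property, weakly null sequences are norm null. -/
def SchurProperty (E : Type*) [NormedAddCommGroup E] [NormedSpace ℂ E] : Prop :=
  ∀ x : ℕ → E, (∀ f : StrongDual ℂ E, Tendsto (fun n => f (x n)) atTop (𝓝 0)) →
    Tendsto x atTop (𝓝 0)

/-- Banach–Alaoglu in the bidual: a bounded sequence converges weak* along any ultrafilter. -/
theorem exists_limit_functional {x : ℕ → E} {M : ℝ} (hx : ∀ n, ‖x n‖ ≤ M) (U : Ultrafilter ℕ) :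
    ∃ φ : StrongDual ℂ (StrongDual ℂ E),
      ∀ f : StrongDual ℂ E, Tendsto (fun n => f (x n)) U (𝓝 (φ f)) := by
  let w : ℕ → WeakDual ℂ (StrongDual ℂ E) := fun n =>
    StrongDual.toWeakDual (NormedSpace.inclusionInDoubleDual ℂ E (x n))
  have hK := WeakDual.isCompact_closedBall (𝕜 := ℂ)
    (0 : StrongDual ℂ (StrongDual ℂ E)) M
  have hmem : ∀ n, w n ∈ WeakDual.toStrongDual ⁻¹' Metric.closedBall
      (0 : StrongDual ℂ (StrongDual ℂ E)) M := fun n => by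
    exact (dist_zero_right (NormedSpace.inclusionInDoubleDual ℂ E (x n))).le.trans <| (NormedSpace.double_dual_bound ℂ E (x n)).trans (hx n)
  obtain ⟨φ, -, hφ⟩ := hK.ultrafilter_le_nhds (U.map w) (le_principal_iff.2 (univ_mem' hmem : w ⁻¹' _ ∈ U))
  refine ⟨WeakDual.toStrongDual φ, fun f => ?_⟩
  exact ((WeakDual.eval_continuous f).tendsto φ).comp hφ

/-- In a space with the Schur property, a sequence of unit vectors has a nonzero limit functional
on the dual. -/
theorem SchurProperty.exists_limit_functional_ne_zero (hE : SchurProperty E) {x : ℕ → E}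
    (hx : ∀ n, ‖x n‖ = 1) : ∃ (U : Ultrafilter ℕ) (φ : StrongDual ℂ (StrongDual ℂ E)),
      ↑U ≤ (atTop : Filter ℕ) ∧ φ ≠ 0 ∧
      ∀ f : StrongDual ℂ E, Tendsto (fun n => f (x n)) U (𝓝 (φ f)) := by
  have h1 : ¬ ∀ f : StrongDual ℂ E, Tendsto (fun n => f (x n)) atTop (𝓝 0) := fun h => by
    have := (hE x h).norm
    simp [hx] at this
  simp only [not_forall, tendsto_iff_ultrafilter _ atTop] at h1
  obtain ⟨f, U, hU, hf⟩ := h1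
  obtain ⟨φ, hφ⟩ := exists_limit_functional (fun n => (hx n).le) U
  exact ⟨U, φ, hU, fun h0 => hf (by simpa [h0] using hφ f), hφ⟩

/-- If `A` is not bounded below, unit vectors `x n` with `A (x n) → 0` have a nonzero weak* limit,
which `A**` kills. -/
theorem SchurProperty.boundedBelow (hE : SchurProperty E) {A : E →L[ℂ] E}
    (hA : ∀ φ, dualMap (dualMap A) φ = 0 → φ = 0) : BoundedBelow A := by
  by_contra hbb
  have h1 : ∀ n : ℕ, ∃ x : E, ‖x‖ = 1 ∧ ‖A x‖ < 1 / ((n : ℝ) + 1) := fun n => by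
    simp only [BoundedBelow, not_exists, not_and, not_forall, not_le] at hbb
    obtain ⟨y, hy⟩ := hbb (1 / ((n : ℝ) + 1)) Nat.one_div_pos_of_nat
    have hy0 : ‖y‖ ≠ 0 := fun h => by
      rw [h, mul_zero, norm_eq_zero.1 h, map_zero, norm_zero] at hy
      exact lt_irrefl _ hy
    have hyp : 0 < ‖y‖ := (norm_nonneg y).lt_of_ne' hy0
    refine ⟨(‖y‖⁻¹ : ℂ) • y, ?_, ?_⟩
    · rw [norm_smul, norm_inv, Complex.norm_real, norm_norm, inv_mul_cancel₀ hy0]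
    · rw [map_smul, norm_smul, norm_inv, Complex.norm_real, norm_norm, inv_mul_lt_iff₀ hyp, mul_comm]
      exact hy
  choose x hx hAx using h1
  obtain ⟨U, φ, hU, hφ0, hφ⟩ := hE.exists_limit_functional_ne_zero hx
  refine hφ0 (hA φ ?_)
  ext f
  have hA0 : Tendsto (fun n => A (x n)) atTop (𝓝 0) :=
    squeeze_zero_norm (fun n => (hAx n).le) tendsto_one_div_add_atTop_nhds_zero_nat
  have h2 : Tendsto (fun n => f (A (x n))) U (𝓝 0) := by
    have := (f.continuous.tendsto 0).comp (hA0.mono_left hU)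
    rwa [map_zero] at this
  exact tendsto_nhds_unique (hφ (dualMap A f)) h2

/-- Cut the orbit into blocks of length at most `N`, each doubling the norm; the leftover of fewer
than `N` steps costs at most the factor `c ^ N`. -/
theorem pow_growth {A : E →L[ℂ] E} {c : ℝ} (hc : 0 < c) (hc1 : c ≤ 1)
    (h : ∀ x, c * ‖x‖ ≤ ‖A x‖) {N : ℕ}
    (hN : ∀ x, ∃ k, 1 ≤ k ∧ k ≤ N ∧ 2 * ‖x‖ ≤ ‖(A ^ k) x‖) (j n : ℕ) (hjn : j * N ≤ n) (x : E) :
    c ^ N * 2 ^ j * ‖x‖ ≤ ‖(A ^ n) x‖ := by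
  have hstep : ∀ k n : ℕ, k ≤ n → ∀ x, (A ^ (n - k)) ((A ^ k) x) = (A ^ n) x := fun k n hk x => by
    rw [← mul_apply_eq_comp, ← pow_add, Nat.sub_add_cancel hk]
  have hpow : ∀ n x, c ^ n * ‖x‖ ≤ ‖(A ^ n) x‖ := fun n => by
    induction n with
    | zero => simp
    | succ n ih =>
      intro x
      rw [pow_succ, pow_succ, mul_apply_eq_comp, mul_assoc]
      exact (mul_le_mul_of_nonneg_left (h x) (by positivity)).trans (ih (A x))
  induction n using Nat.strong_induction_on generalizing j x with
  | _ n ih =>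
    rcases lt_or_ge n N with hlt | hge
    · have hj : j = 0 := by
        by_contra hj
        have := Nat.le_mul_of_pos_left N (Nat.pos_of_ne_zero hj)
        omega
      subst hj
      rw [pow_zero, mul_one]
      refine le_trans ?_ (hpow n x)
      exact mul_le_mul_of_nonneg_right (pow_le_pow_of_le_one hc.le hc1 hlt.le) (norm_nonneg x)
    · obtain ⟨k, hk1, hkN, hk⟩ := hN x
      have h1 : (j - 1) * N ≤ n - k := by
        rw [Nat.sub_mul]; omega
      have h2 := ih (n - k) (by omega) (j - 1) h1 ((A ^ k) x)
      rw [hstep k n (hkN.trans hge)] at h2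
      refine le_trans ?_ h2
      have h3 : (2 : ℝ) ^ j ≤ 2 ^ (j - 1) * 2 := by
        rw [← pow_succ]
        exact pow_le_pow_right₀ (by norm_num) (by omega)
      calc c ^ N * 2 ^ j * ‖x‖ ≤ c ^ N * (2 ^ (j - 1) * 2) * ‖x‖ := by gcongr
        _ = c ^ N * 2 ^ (j - 1) * (2 * ‖x‖) := by ring
        _ ≤ _ := by gcongr

theorem dualMap_iterate_apply (A : E →L[ℂ] E) (n : ℕ) (f : StrongDual ℂ E) (x : E) :
    (dualMap A)^[n] f x = f (A^[n] x) := by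
  induction n generalizing f with
  | zero => rfl
  | succ n ih =>
    rw [Function.iterate_succ_apply, ih, dualMap_apply, Function.iterate_succ_apply']

/-- The powers of an operator without approximate eigenvalues in the closed unit disc are
eventually expanding by any prescribed factor, in a space with the Schur property. -/
theorem SchurProperty.eventually_le_norm_pow (hE : SchurProperty E) {A : E →L[ℂ] E}
    (hA : ∀ μ : ℂ, ‖μ‖ ≤ 1 → BoundedBelow (A - algebraMap ℂ (E →L[ℂ] E) μ)) (M : ℝ) :
    ∀ᶠ n in atTop, ∀ x, M * ‖x‖ ≤ ‖(A ^ n) x‖ := by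
  by_cases hN : ∃ N, ∀ x : E, ∃ k, 1 ≤ k ∧ k ≤ N ∧ 2 * ‖x‖ ≤ ‖(A ^ k) x‖
  · obtain ⟨N, hN⟩ := hN
    obtain ⟨c, hc, h⟩ : BoundedBelow A := by simpa using hA 0 (by simp)
    have h' : ∀ x, min c 1 * ‖x‖ ≤ ‖A x‖ := fun x =>
      (mul_le_mul_of_nonneg_right (min_le_left c 1) (norm_nonneg x)).trans (h x)
    have hc' : 0 < min c 1 := lt_min hc one_pos
    obtain ⟨j, hj⟩ := ((tendsto_pow_atTop_atTop_of_one_lt (one_lt_two (α := ℝ))).const_mul_atTop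
      (pow_pos hc' N)).eventually_ge_atTop M |>.exists
    filter_upwards [eventually_ge_atTop (j * N)] with n hn x
    exact (mul_le_mul_of_nonneg_right hj (norm_nonneg x)).trans
      (pow_growth hc' (min_le_right c 1) h' hN j n hn x)
  · exfalso
    push Not at hN
    have h1 : ∀ N : ℕ, ∃ x : E, ‖x‖ = 1 ∧ ∀ k, 1 ≤ k → k ≤ N → ‖(A ^ k) x‖ ≤ 2 := fun N => by
      -- Using `N + 1` makes `k = 1` available even for `N = 0`; the strict inequality there forces
      -- `y ≠ 0`.
      obtain ⟨y, hy⟩ := hN (N + 1)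
      have hyp : 0 < ‖y‖ := by
        have := (norm_nonneg _).trans_lt (hy 1 le_rfl (by omega))
        linarith
      refine ⟨(‖y‖⁻¹ : ℂ) • y, ?_, fun k hk hkN => ?_⟩
      · rw [norm_smul, norm_inv, Complex.norm_real, norm_norm, inv_mul_cancel₀ hyp.ne']
      · rw [map_smul, norm_smul, norm_inv, Complex.norm_real, norm_norm, inv_mul_le_iff₀ hyp,
          mul_comm]
        exact (hy k hk (by omega)).le
    choose x hx hAx using h1
    obtain ⟨U, φ, hU, hφ0, hφ⟩ := hE.exists_limit_functional_ne_zero hx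
    -- The bound `2` covers only `k ≥ 1`; `‖φ‖` covers `k = 0`.
    refine hφ0 (eq_zero_of_bounded_orbit (A := dualMap (dualMap A)) (C := max ‖φ‖ 2)
      (fun μ hμ => ?_) fun k => ?_)
    · obtain ⟨c, hc, h⟩ := (hA μ hμ).dualMap_dualMap
      refine ⟨c, hc, fun ψ => ?_⟩
      rw [← dualMap_dualMap_sub_algebraMap_apply]
      exact h ψ
    · rcases Nat.eq_zero_or_pos k with rfl | hk
      · exact le_max_left _ _
      · refine le_trans (ContinuousLinearMap.opNorm_le_bound _ zero_le_two fun f => ?_)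
          (le_max_right _ _)
        have h2 : Tendsto (fun n => f ((A ^ k) (x n))) U (𝓝 ((dualMap (dualMap A))^[k] φ f)) := by
          rw [dualMap_iterate_apply]
          refine (hφ _).congr fun n => ?_
          rw [dualMap_iterate_apply, FunLike.coe_pow_eq_iterate]
        refine le_of_tendsto h2.norm ?_
        filter_upwards [hU (eventually_ge_atTop k)] with n hn
        refine (f.le_opNorm _).trans ?_
        rw [mul_comm]
        exact mul_le_mul_of_nonneg_right (hAx n k hk hn) (norm_nonneg f)

end Schur

/-! ### The Schur property of `l^1` -/

section LOneSchur

theorem LOne.summable_norm (x : LOne) : Summable fun k => ‖x k‖ := by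
  simpa using (lp.memℓp x).summable (by simp)

theorem LOne.norm_eq_tsum (x : LOne) : ‖x‖ = ∑' k, ‖x k‖ := by
  simpa using lp.norm_eq_tsum_rpow (by simp) x

theorem LOne.norm_mul_le {y : ℕ → ℂ} (hy : ∀ k, ‖y k‖ ≤ 1) (x : LOne) (k : ℕ) :
    ‖y k * x k‖ ≤ ‖x k‖ := by
  rw [norm_mul]
  exact mul_le_of_le_one_left (norm_nonneg _) (hy k)

/-- A scalar of modulus at most one which rotates `z` onto the nonnegative reals. -/
theorem exists_mul_eq_norm (z : ℂ) : ∃ w : ℂ, ‖w‖ ≤ 1 ∧ w * z = ‖z‖ := by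
  rcases eq_or_ne z 0 with rfl | hz
  · exact ⟨0, by simp, by simp⟩
  · have h : (‖z‖ : ℂ) ≠ 0 := by simpa using hz
    refine ⟨‖z‖ / z, ?_, by field_simp⟩
    simp [hz]

/-- Off `F` the multipliers are free: choosing phases that make each term `‖x k‖` bounds the tail,
while the terms in `F` are estimated trivially. -/
theorem LOne.norm_le_of_forall_agree {x : LOne} {y₀ : ℕ → ℂ} (hy₀ : ∀ k, ‖y₀ k‖ ≤ 1) {F : Finset ℕ}
    {ε : ℝ} (h : ∀ y : ℕ → ℂ, (∀ k, ‖y k‖ ≤ 1) → (∀ k ∈ F, y k = y₀ k) →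
      ‖∑' k, y k * x k‖ ≤ ε) : ‖x‖ ≤ 2 * ∑ k ∈ F, ‖x k‖ + ε := by
  choose w hw hwz using exists_mul_eq_norm
  classical
  let y : ℕ → ℂ := fun k => if k ∈ F then y₀ k else w (x k)
  have hy : ∀ k, ‖y k‖ ≤ 1 := fun k => by
    by_cases hk : k ∈ F
    · simpa [y, hk] using hy₀ k
    · simpa [y, hk] using hw (x k)
  have hsx := LOne.summable_norm x
  have hsy : Summable fun k => y k * x k :=
    Summable.of_norm_bounded hsx (LOne.norm_mul_le hy x)
  have h1 := h y hy fun k hk => by simp [y, hk]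
  have h2 : ∑' k, ‖x k‖ = ∑ k ∈ F, ‖x k‖ + ∑' k : {k // k ∉ F}, ‖x k‖ :=
    (hsx.sum_add_tsum_subtype_compl F).symm
  have h3 : ∑' k, y k * x k = ∑ k ∈ F, y k * x k + ((∑' k : {k // k ∉ F}, ‖x k‖ : ℝ) : ℂ) := by
    rw [← hsy.sum_add_tsum_subtype_compl F, Complex.ofReal_tsum]
    congr 1
    refine tsum_congr fun k => ?_
    simp [y, k.2, hwz]
  have h4 : ‖∑ k ∈ F, y k * x k‖ ≤ ∑ k ∈ F, ‖x k‖ :=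
    norm_sum_le_of_le _ fun k _ => LOne.norm_mul_le hy x k
  have h5 : ‖((∑' k : {k // k ∉ F}, ‖x k‖ : ℝ) : ℂ)‖ = ∑' k : {k // k ∉ F}, ‖x k‖ := by
    rw [Complex.norm_real, Real.norm_of_nonneg (tsum_nonneg fun _ => norm_nonneg _)]
  have h6 : ((∑' k : {k // k ∉ F}, ‖x k‖ : ℝ) : ℂ) =
      ∑' k, y k * x k - ∑ k ∈ F, y k * x k := by rw [h3]; ring
  have h7 := norm_sub_le (∑' k, y k * x k) (∑ k ∈ F, y k * x k)
  rw [← h6, h5] at h7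
  rw [LOne.norm_eq_tsum, h2]
  linarith

/-- Baire category on the compact product of discs: smallness of the pairings is uniform in `n` on
some basic open set, which constrains only finitely many coordinates, and on those `x n` tends to
zero. -/
theorem schurProperty_lOne : SchurProperty LOne := by
  intro x hx
  have hpair : ∀ y : ℕ → ℂ, (∀ k, ‖y k‖ ≤ 1) →
      Tendsto (fun n => ∑' k, y k * x n k) atTop (𝓝 0) := fun y hy =>
    hx (pairing ⟨y, memℓp_infty ⟨1, by rintro _ ⟨k, rfl⟩; exact hy k⟩⟩)
  have hcoord : ∀ k, Tendsto (fun n => ‖x n k‖) atTop (𝓝 0) := fun k => by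
    have := (hx (lp.evalCLM ℂ (fun _ : ℕ => ℂ) 1 k)).norm
    rwa [norm_zero] at this
  rw [tendsto_zero_iff_norm_tendsto_zero, Metric.tendsto_atTop]
  intro ε hε
  let K := ℕ → Metric.closedBall (0 : ℂ) 1
  have hK : ∀ (y : K) k, ‖(y k : ℂ)‖ ≤ 1 := fun y k => mem_closedBall_zero_iff.1 (y k).2
  let C : ℕ → Set K := fun m => ⋂ n ≥ m, {y | ‖∑' k, (y k : ℂ) * x n k‖ ≤ ε / 3}
  have hcont : ∀ n, Continuous fun y : K => ∑' k, (y k : ℂ) * x n k := fun n =>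
    continuous_tsum (fun k => by fun_prop) (LOne.summable_norm (x n))
      fun k y => LOne.norm_mul_le (hK y) (x n) k
  have hC : ∀ m, IsClosed (C m) := fun m => isClosed_biInter fun n _ =>
    isClosed_le (hcont n).norm continuous_const
  have hU : ⋃ m, C m = Set.univ := by
    refine Set.eq_univ_of_forall fun y => ?_
    have h0 := (hpair (fun k => y k) (hK y)).norm
    rw [norm_zero] at h0
    obtain ⟨m, hm⟩ := eventually_atTop.1 (h0.eventually_le_const (by positivity : (0 : ℝ) < ε / 3))
    exact Set.mem_iUnion.2 ⟨m, Set.mem_iInter₂.2 hm⟩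
  obtain ⟨m, y₀, hy₀⟩ := nonempty_interior_of_iUnion_of_closed hC hU
  obtain ⟨F, V, hV, hsub⟩ := (isOpen_pi_iff.1 isOpen_interior) y₀ hy₀
  have hbound : ∀ n ≥ m, ‖x n‖ ≤ 2 * ∑ k ∈ F, ‖x n k‖ + ε / 3 := fun n hn =>
    LOne.norm_le_of_forall_agree (hK y₀) fun y hy hF => by
      let z : K := fun k => ⟨y k, mem_closedBall_zero_iff.2 (hy k)⟩
      have hz : z ∈ C m := interior_subset (hsub fun k hk => by
        have : z k = y₀ k := Subtype.ext (hF k hk)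
        rw [this]
        exact (hV k hk).2)
      exact Set.mem_iInter₂.1 hz n hn
  have hlim : Tendsto (fun n => 2 * ∑ k ∈ F, ‖x n k‖) atTop (𝓝 0) := by
    simpa using (tendsto_finsetSum F fun k _ => hcoord k).const_mul 2
  obtain ⟨N, hN⟩ := eventually_atTop.1 (hlim.eventually_lt_const (by positivity : (0 : ℝ) < ε / 3))
  refine ⟨max m N, fun n hn => ?_⟩
  have h1 := hbound n ((le_max_left _ _).trans hn)
  have h2 := hN n ((le_max_right _ _).trans hn)
  rw [dist_zero_right, norm_norm]
  linarith

end LOneSchur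

/-! ### `J`-class adjoints and disc-expanding operators -/

section Characterization

variable {E F : Type*} [NormedAddCommGroup E] [NormedSpace ℂ E]
  [NormedAddCommGroup F] [NormedSpace ℂ F]

/-- The operators `A` such that `A - μ` is bounded below but not invertible for all `μ` in the
closed unit disc. -/
def discExpanding (E : Type*) [NormedAddCommGroup E] [NormedSpace ℂ E] : Set (E →L[ℂ] E) :=
  {A | ∀ μ ∈ Metric.closedBall (0 : ℂ) 1,
    BoundedBelow (A - algebraMap ℂ (E →L[ℂ] E) μ) ∧ ¬ IsUnit (A - algebraMap ℂ (E →L[ℂ] E) μ)}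

theorem isOpen_discExpanding [CompleteSpace E] : IsOpen (discExpanding E) := by
  refine isOpen_iff_mem_nhds.2 fun A hA => ?_
  refine (isCompact_closedBall (0 : ℂ) 1).eventually_forall_of_forall_eventually fun μ hμ => ?_
  have hcont : Continuous fun p : (E →L[ℂ] E) × ℂ => p.1 - algebraMap ℂ (E →L[ℂ] E) p.2 :=
    continuous_fst.sub ((algebraMapCLM ℂ (E →L[ℂ] E)).continuous.comp continuous_snd)
  exact (isOpen_boundedBelow_not_isUnit.preimage hcont).mem_nhds
    (show (A, μ) ∈ (fun p : (E →L[ℂ] E) × ℂ => p.1 - algebraMap ℂ (E →L[ℂ] E) p.2) ⁻¹'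
      {A | BoundedBelow A ∧ ¬ IsUnit A} from hA μ hμ)

theorem mem_discExpanding_of_spectrum [CompleteSpace E] {A : E →L[ℂ] E}
    (hA : ∀ μ ∈ Metric.closedBall (0 : ℂ) 1, BoundedBelow (A - algebraMap ℂ (E →L[ℂ] E) μ))
    (hne : (spectrum ℂ A ∩ Metric.closedBall 0 1).Nonempty) : A ∈ discExpanding E := fun μ hμ =>
  ⟨hA μ hμ, (mem_spectrum_iff A μ).1 <| subset_spectrum_of_boundedBelow
    (convex_closedBall (0 : ℂ) 1).isPreconnected hA hne hμ⟩

/-- The adjoint of a `J`-class operator has no eigenvalue in the closed unit disc. -/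
theorem IsJClass.disjoint_pointSpectrum {T : F →L[ℂ] F} (hT : IsJClass T) :
    Metric.closedBall (0 : ℂ) 1 ∩ pointSpectrum (dualMap T) = ∅ := by
  obtain ⟨x, -, hJ⟩ := hT
  refine Set.eq_empty_of_forall_notMem ?_
  rintro μ ⟨hμ, hev⟩
  rw [mem_closedBall_zero_iff] at hμ
  obtain ⟨φ, hφ⟩ := Module.End.HasEigenvalue.exists_hasEigenvector hev
  have hφ1 : ∀ y, φ (T y) = μ * φ y := DFunLike.congr_fun hφ.apply_eq_smul
  have hpow : ∀ n y, φ ((T ^ n) y) = μ ^ n * φ y := fun n => by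
    induction n with
    | zero => simp
    | succ n ih => intro y; rw [pow_succ, mul_apply_eq_comp, ih, hφ1, pow_succ, mul_assoc]
  have hbd : ∀ y, ‖φ y‖ ≤ ‖φ x‖ := fun y => by
    obtain ⟨k, u, -, hu, hTu⟩ : y ∈ JSet T x := hJ ▸ Set.mem_univ y
    have h1 := ((φ.continuous.tendsto y).comp hTu).norm
    have h2 := ((φ.continuous.tendsto x).comp hu).norm
    refine le_of_tendsto_of_tendsto' h1 h2 fun n => ?_
    simp only [Function.comp_apply, hpow, norm_mul, norm_pow]
    exact mul_le_of_le_one_left (norm_nonneg _) (pow_le_one₀ (norm_nonneg _) hμ)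
  refine hφ.2 (ContinuousLinearMap.ext fun y => ?_)
  by_contra hy
  have hy' : φ y ≠ 0 := hy
  -- Scaled so that `φ` takes the value `‖φ x‖ + 1`, exceeding the bound.
  have h := hbd ((((‖φ x‖ + 1 : ℝ) : ℂ) / φ y) • y)
  rw [map_smul, smul_eq_mul, div_mul_cancel₀ _ hy', Complex.norm_real,
    Real.norm_of_nonneg (by positivity)] at h
  linarith

variable {S : E →L[ℂ] E} {T : F →L[ℂ] F} {e : F ≃ₗᵢ[ℂ] StrongDual ℂ E}

theorem pow_intertwine (hT : ∀ y, e (T y) = dualMap S (e y)) (n : ℕ) (y : F) (x : E) :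
    e ((T ^ n) y) x = e y ((S ^ n) x) := by
  induction n generalizing y with
  | zero => rfl
  | succ n ih =>
    rw [pow_succ, mul_apply_eq_comp, ih, hT, dualMap_apply, pow_succ', mul_apply_eq_comp]

theorem boundedBelow_of_disjoint_pointSpectrum (hE : SchurProperty E)
    (hT : ∀ y, e (T y) = dualMap S (e y))
    (h : Metric.closedBall (0 : ℂ) 1 ∩ pointSpectrum (dualMap T) = ∅) (μ : ℂ)
    (hμ : μ ∈ Metric.closedBall (0 : ℂ) 1) : BoundedBelow (S - algebraMap ℂ (E →L[ℂ] E) μ) := by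
  refine hE.boundedBelow fun ψ hψ => ?_
  rw [dualMap_dualMap_sub_algebraMap_apply, sub_eq_zero] at hψ
  let φ : StrongDual ℂ F := ψ ∘L (e.toContinuousLinearEquiv : F →L[ℂ] StrongDual ℂ E)
  have hφ : dualMap T φ = μ • φ := by
    ext y
    change ψ (e (T y)) = μ • ψ (e y)
    rw [hT]
    exact DFunLike.congr_fun hψ (e y)
  by_contra hψ0
  have hφ0 : φ ≠ 0 := fun h0 => hψ0 <| by
    ext f
    have := DFunLike.congr_fun h0 (e.symm f)
    change ψ (e (e.symm f)) = 0 at this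
    rwa [e.apply_symm_apply] at this
  have hmem : μ ∈ pointSpectrum (dualMap T) :=
    Module.End.hasEigenvalue_of_hasEigenvector (Module.End.hasEigenvector_iff.2
      ⟨Module.End.mem_eigenspace_iff.2 hφ, hφ0⟩)
  exact Set.eq_empty_iff_forall_notMem.1 h μ ⟨hμ, hmem⟩

theorem isJClass_of_mem_discExpanding [CompleteSpace E] (hE : SchurProperty E)
    (hT : ∀ y, e (T y) = dualMap S (e y)) (hS : S ∈ discExpanding E) : IsJClass T := by
  obtain ⟨f, hf0, hf⟩ : ∃ f : StrongDual ℂ E, f ≠ 0 ∧ dualMap S f = 0 := by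
    have h0 := hS 0 (by simp)
    rw [map_zero, sub_zero] at h0
    exact h0.1.exists_dualMap_eq_zero h0.2
  have hgrow := hE.eventually_le_norm_pow fun μ hμ => (hS μ (mem_closedBall_zero_iff.2 hμ)).1
  -- Exponents `k + 1` are positive, so `(S*)^(k + 1)` kills `f`.
  have hk : ∀ m : ℕ, ∃ᶠ k in atTop, ∀ x, ((m : ℝ) + 1) * ‖x‖ ≤ ‖(S ^ (k + 1)) x‖ := fun m =>
    ((tendsto_add_atTop_nat 1).eventually (hgrow ((m : ℝ) + 1))).frequently
  obtain ⟨k, hkmono, hk⟩ := extraction_forall_of_frequently hk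
  refine ⟨e.symm f, by simpa using hf0, Set.eq_univ_of_forall fun y => ?_⟩
  have hg : ∀ m : ℕ, ∃ g, dualMap (S ^ (k m + 1)) g = e y ∧ ((m : ℝ) + 1) * ‖g‖ ≤ ‖e y‖ :=
    fun m => exists_dualMap_eq (by positivity) (hk m) (e y)
  choose g hgy hgn using hg
  refine ⟨fun m => k m + 1, fun m => e.symm f + e.symm (g m), hkmono.add_const 1, ?_, ?_⟩
  · have h0 : Tendsto (fun m => e.symm (g m)) atTop (𝓝 0) := by
      refine squeeze_zero_norm (a := fun m : ℕ => ‖e y‖ * (1 / ((m : ℝ) + 1))) (fun m => ?_) ?_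
      · rw [e.symm.norm_map, mul_one_div, le_div_iff₀' (by positivity)]
        exact hgn m
      · simpa using tendsto_one_div_add_atTop_nhds_zero_nat.const_mul ‖e y‖
    simpa using h0.const_add (e.symm f)
  · refine tendsto_const_nhds.congr fun m => e.injective ?_
    ext x
    have h1 : f ((S ^ (k m + 1)) x) = 0 := by
      rw [pow_succ', mul_apply_eq_comp]
      exact DFunLike.congr_fun hf _
    have h2 : g m ((S ^ (k m + 1)) x) = e y x := DFunLike.congr_fun (hgy m) x
    rw [pow_intertwine hT, map_add, e.apply_symm_apply, e.apply_symm_apply, add_apply, h1, h2,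
      zero_add]

theorem IsJClass.mem_discExpanding [CompleteSpace E] (hE : SchurProperty E)
    (hT : ∀ y, e (T y) = dualMap S (e y)) (hJ : IsJClass T) : S ∈ discExpanding E := by
  have hbb := boundedBelow_of_disjoint_pointSpectrum hE hT hJ.disjoint_pointSpectrum
  refine mem_discExpanding_of_spectrum hbb ⟨0, ?_, by simp⟩
  rw [mem_spectrum_iff, map_zero, sub_zero]
  intro hu
  obtain ⟨x, hx0, hJx⟩ := hJ
  have hgrow := hE.eventually_le_norm_pow (fun μ hμ => hbb μ (mem_closedBall_zero_iff.2 hμ))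
  -- Since `S ^ n` is invertible with inverse of norm at most `1/M`, so is its adjoint, which gives
  -- the lower bound for `T ^ n`.
  have hexp : ∀ (n : ℕ) (M : ℝ), 0 < M → (∀ z, M * ‖z‖ ≤ ‖(S ^ n) z‖) →
      ∀ y, M * ‖y‖ ≤ ‖(T ^ n) y‖ := fun n M hM h y => by
    rw [← le_div_iff₀' hM, ← e.norm_map y]
    refine (e y).opNorm_le_bound (by positivity) fun z => ?_
    obtain ⟨v, hv⟩ := hu.pow n
    have hz : (S ^ n) ((↑v⁻¹ : E →L[ℂ] E) z) = z := by
      rw [← hv, ← mul_apply_eq_comp, Units.mul_inv, one_apply_eq_self]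
    have h1 := h ((↑v⁻¹ : E →L[ℂ] E) z)
    calc ‖e y z‖ = ‖e ((T ^ n) y) ((↑v⁻¹ : E →L[ℂ] E) z)‖ := by rw [pow_intertwine hT, hz]
      _ ≤ ‖e ((T ^ n) y)‖ * ‖(↑v⁻¹ : E →L[ℂ] E) z‖ := ContinuousLinearMap.le_opNorm _ _
      _ = ‖(T ^ n) y‖ / M * (M * ‖(↑v⁻¹ : E →L[ℂ] E) z‖) := by rw [e.norm_map]; field_simp
      _ ≤ ‖(T ^ n) y‖ / M * ‖z‖ := by rw [hz] at h1; gcongr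
  -- Take `0` as target: expansion makes `‖u n‖` at most `‖T^(k n) (u n)‖ → 0`, while `u n → x ≠ 0`.
  obtain ⟨k, u, hk, hu', hTu⟩ : (0 : F) ∈ JSet T x := hJx ▸ Set.mem_univ _
  have h2 : ∀ᶠ n in atTop, ‖u n‖ ≤ ‖(T ^ k n) (u n)‖ := by
    filter_upwards [hk.tendsto_atTop.eventually (hgrow 1)] with n hn
    simpa using hexp (k n) 1 one_pos hn (u n)
  have h3 := le_of_tendsto_of_tendsto hu'.norm hTu.norm h2
  rw [norm_zero] at h3
  exact hx0 (norm_le_zero_iff.1 h3)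

end Characterization

theorem lInfEquivDual_adjointLInf (S : LOne →L[ℂ] LOne) (y : LInf) :
    lInfEquivDual (adjointLInf S y) = dualMap S (lInfEquivDual y) :=
  lInfEquivDual.apply_symm_apply _

theorem JA_eq_discExpanding : JA = discExpanding LOne :=
  Set.ext fun S => ⟨fun h => h.mem_discExpanding schurProperty_lOne (lInfEquivDual_adjointLInf S),
    isJClass_of_mem_discExpanding schurProperty_lOne (lInfEquivDual_adjointLInf S)⟩

end JClass

end

/-- `JA(l^1)` is norm-open in `L(l^1)`, and it is the set of all `S` such that `σ(S)` meets the
unit circle while `σ_p(S**)` misses the closed unit disc. -/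
theorem corollary3p9 :
    IsOpen JClass.JA ∧
      JClass.JA =
        {S : JClass.LOne →L[ℂ] JClass.LOne |
          (spectrum ℂ S ∩ Metric.sphere (0 : ℂ) 1).Nonempty ∧
          Metric.closedBall (0 : ℂ) 1 ∩
            JClass.pointSpectrum (JClass.dualMap (JClass.adjointLInf S)) = ∅} := by
  rw [JClass.JA_eq_discExpanding]
  refine ⟨JClass.isOpen_discExpanding, Set.ext fun S => ⟨fun hS => ⟨⟨1, ?_, by simp⟩, ?_⟩, ?_⟩⟩
  · exact (JClass.mem_spectrum_iff S 1).2 (hS 1 (by simp)).2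
  · exact (JClass.isJClass_of_mem_discExpanding JClass.schurProperty_lOne
      (JClass.lInfEquivDual_adjointLInf S) hS).disjoint_pointSpectrum
  · rintro ⟨⟨μ, hμ, hμ1⟩, hp⟩
    exact JClass.mem_discExpanding_of_spectrum
      (JClass.boundedBelow_of_disjoint_pointSpectrum JClass.schurProperty_lOne
        (JClass.lInfEquivDual_adjointLInf S) hp)
      ⟨μ, hμ, Metric.sphere_subset_closedBall hμ1⟩
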